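/- A lower semi-continuous submeasure on $\mathbb{N}$ is a function $\varphi:\mathcal P(\mathbb N)\to[0,\infty]$ with $\varphi(\emptyset)=0$, $\varphi(X)\le\varphi(Y)$ whenever $X\subseteq Y$, $\varphi(X\cup Y)\le\varphi(X)+\varphi(Y)$, $\varphi(\{n\})<\infty$ for every $n$, and $\varphi(X)=\lim_{n\to\infty}\varphi(X\cap\{0,\dots,n-1\})$ for every $X\subseteq\mathbb N$. For a family $\mathcal F\subseteq\mathcal P(\mathbb N)$, let $\mathbb M(\mathcal F)$ be the Mathias forcing with side conditions from $\mathcal F$: its conditions are the pairs $(s,A)$ with $s\subseteq\mathbb N$ finite, $A\in\mathcal F$ infinite, and $m<n$ for all $m\in s$, $n\in A$; the order is $(s_1,A_1)\le(s_2,A_2)$ iff $s_1\supseteq s_2$, $A_1\subseteq A_2$ and $s_1\setminus s_2\subseteq A_2$. A forcing notion $\mathbb P$ is proper if for every regular cardinal $\kappa>2^{|\mathbb P|}$, every countable elementary submodel $M\prec(H_\kappa,\in)$ containing $\mathbb P$ together with its order, and every $p\in\mathbb P\cap M$, there is $q\le p$ that is $(M,\mathbb P)$-generic, i.e. for every dense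 subset $D\in M$ of $\mathbb P$, every $r\le q$ is compatible with some element of $D\cap M$. Here $H_\kappa$ is the set of all sets whose transitive closure has cardinality less than $\kappa$. **Theorem.** Let $(\varphi_m)_{m\in\mathbb N}$ be a sequence of lower semi-continuous submeasures on $\mathbb N$ such that $\lim_{m\to\infty}\varphi_m(\{n\})=0$ for every $n\in\mathbb N$, and let $\varphi^-(A)=\liminf_{m\to\infty}\varphi_m(A)$. Then for every real $\varepsilon\ge0$ the forcing $\mathbb M^{\varphi^-}_{\ge\varepsilon}=\mathbb M(\{A\subseteq\mathbb N:\varphi^-(A)\ge\varepsilon\})$ is proper. **Corollary.** Let $d^-(A)=\liminf_{n\to\infty}\frac{|A\cap\{0,\dots,n-1\}|}{n}$ be the lower density. Then for every real $\varepsilon$ with $0\le\varepsilon\le1$ the forcing $\mathbb M^-_{\ge\varepsilon}=\mathbb M(\{A\subseteq\mathbb N:d^-(A)\ge\varepsilon\})$ is proper. -/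

import Mathlib

open Filter Topology
open scoped ENNReal

universe u

noncomputable section

namespace DensityMathias

/-! ### The structure `(H_κ, ∈)` and its elementary submodels -/

/-- The relation symbols of the language of set theory: one binary symbol. -/
inductive SetRel : ℕ → Type
  | mem : SetRel 2

/-- The first-order language `{∈}`. -/
def setLang : FirstOrder.Language := ⟨fun _ => Empty, SetRel⟩

/-- `H_κ`: the sets whose transitive closure has fewer than `κ` elements (equivalently, the
subsets of transitive sets with fewer than `κ` elements). -/
def H (κ : Cardinal.{u}) : Set ZFSet.{u} :=
  {x | ∃ t : ZFSet.{u}, t.IsTransitive ∧ x ⊆ t ∧ t.card < κ}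

/-- `H_κ` as a structure for `{∈}`, with the true membership relation. -/
instance setStructure (κ : Cardinal.{u}) : setLang.Structure (H κ) where
  funMap := fun f _ => f.elim
  RelMap := fun r =>
    match r with
    | SetRel.mem => fun v => (v 0 : ZFSet.{u}) ∈ (v 1 : ZFSet.{u})

/-- `M` is (the underlying set of) an elementary submodel of `(H_κ, ∈)`. -/
def IsElementarySubmodel (M : Set ZFSet.{u}) (κ : Cardinal.{u}) : Prop :=
  ∃ S : setLang.ElementarySubstructure (H κ), M = Subtype.val '' (S : Set (H κ))

/-! ### Forcing notions and properness -/

/-- A forcing notion: a set `carrier` with a preorder on it, given as a set `rel` of ordered pairs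
(`(p, q) ∈ rel` means that `p` extends `q`). -/
structure ForcingNotion where
  carrier : ZFSet.{u}
  rel : ZFSet.{u}
  rel_subset : rel ⊆ carrier.prod carrier
  refl : ∀ p ∈ carrier, ZFSet.pair p p ∈ rel
  trans : ∀ p q r : ZFSet.{u}, ZFSet.pair p q ∈ rel → ZFSet.pair q r ∈ rel → ZFSet.pair p r ∈ rel

namespace ForcingNotion

variable (P : ForcingNotion.{u})

/-- `p` extends `q`. -/
def LE (p q : ZFSet.{u}) : Prop := ZFSet.pair p q ∈ P.rel

/-- `p` and `q` have a common extension. -/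
def Compatible (p q : ZFSet.{u}) : Prop := ∃ r ∈ P.carrier, P.LE r p ∧ P.LE r q

/-- `D` is a dense subset of the forcing notion. -/
def IsDense (D : ZFSet.{u}) : Prop :=
  D ⊆ P.carrier ∧ ∀ p ∈ P.carrier, ∃ d ∈ D, P.LE d p

/-- `q` is `(M, P)`-generic: for every dense `D ∈ M`, the set `D ∩ M` is predense below `q`. -/
def IsGenericCondition (M : Set ZFSet.{u}) (q : ZFSet.{u}) : Prop :=
  q ∈ P.carrier ∧
    ∀ D ∈ M, P.IsDense D → ∀ r, P.LE r q → ∃ d ∈ D, d ∈ M ∧ P.Compatible d r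

/-- Properness: for every regular `κ > 2 ^ |P|` and every countable `M ≺ H_κ` containing
`P` (with its order), every `p ∈ P ∩ M` has an `(M, P)`-generic extension. -/
def IsProper : Prop :=
  ∀ κ : Cardinal.{u}, κ.IsRegular → 2 ^ P.carrier.card < κ →
    ∀ M : Set ZFSet.{u}, M.Countable → IsElementarySubmodel M κ →
      P.carrier ∈ M → P.rel ∈ M →
        ∀ p ∈ P.carrier, p ∈ M → ∃ q, P.LE q p ∧ P.IsGenericCondition M q

end ForcingNotion

/-- A preordered type, each of whose elements is represented by its own set, is a forcing notion. -/
def forcingOfPreorder (α : Type) [Preorder α] (code : α → ZFSet.{u})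
    (hcode : Function.Injective code) : ForcingNotion.{u} where
  carrier := ZFSet.range code
  rel := ZFSet.range
    (fun x : {x : α × α // x.1 ≤ x.2} => ZFSet.pair (code x.1.1) (code x.1.2))
  rel_subset := by
    intro z hz
    obtain ⟨⟨⟨a, b⟩, hab⟩, rfl⟩ := ZFSet.mem_range.1 hz
    exact ZFSet.pair_mem_prod.2 ⟨ZFSet.mem_range.2 ⟨a, rfl⟩, ZFSet.mem_range.2 ⟨b, rfl⟩⟩
  refl := by
    intro p hp
    obtain ⟨a, rfl⟩ := ZFSet.mem_range.1 hp
    exact ZFSet.mem_range.2 ⟨⟨(a, a), le_refl a⟩, rfl⟩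
  trans := by
    intro p q r hpq hqr
    obtain ⟨⟨⟨a, b⟩, hab⟩, h1⟩ := ZFSet.mem_range.1 hpq
    obtain ⟨⟨⟨c, d⟩, hcd⟩, h2⟩ := ZFSet.mem_range.1 hqr
    obtain ⟨rfl, rfl⟩ := ZFSet.pair_inj.1 h1
    obtain ⟨hc, rfl⟩ := ZFSet.pair_inj.1 h2
    obtain rfl : c = b := hcode hc
    exact ZFSet.mem_range.2 ⟨⟨(a, d), le_trans hab hcd⟩, rfl⟩

/-! ### Mathias forcing -/

/-- The von Neumann natural number `n`. -/
def natCode : ℕ → ZFSet.{u}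
  | 0 => ∅
  | n + 1 => insert (natCode n) (natCode n)

theorem mem_natCode {x : ZFSet.{u}} {n : ℕ} : x ∈ natCode n ↔ ∃ m < n, x = natCode m := by
  induction n with
  | zero => simp [natCode]
  | succ n ih =>
    rw [natCode, ZFSet.mem_insert_iff, ih]
    constructor
    · rintro (h | ⟨m, hm, h⟩)
      · exact ⟨n, n.lt_succ_self, h⟩
      · exact ⟨m, hm.trans n.lt_succ_self, h⟩
    · rintro ⟨m, hm, h⟩
      rcases Nat.lt_succ_iff_lt_or_eq.1 hm with h' | rfl
      · exact Or.inr ⟨m, h', h⟩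
      · exact Or.inl h

theorem natCode_injective : Function.Injective natCode.{u} := by
  intro m n h
  rcases lt_trichotomy m n with hlt | heq | hgt
  · have hm : natCode.{u} m ∈ natCode n := mem_natCode.2 ⟨m, hlt, rfl⟩
    rw [h] at hm
    exact absurd hm (ZFSet.mem_irrefl _)
  · exact heq
  · have hn : natCode.{u} n ∈ natCode m := mem_natCode.2 ⟨n, hgt, rfl⟩
    rw [h] at hn
    exact absurd hn (ZFSet.mem_irrefl _)

/-- A set of natural numbers, as a set of von Neumann natural numbers. -/
def setCode (A : Set ℕ) : ZFSet.{u} := ZFSet.range (fun n : A => natCode (n : ℕ))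

theorem natCode_mem_setCode {A : Set ℕ} {n : ℕ} : natCode.{u} n ∈ setCode.{u} A ↔ n ∈ A := by
  rw [setCode, ZFSet.mem_range]
  constructor
  · rintro ⟨⟨m, hm⟩, h⟩
    exact natCode_injective h ▸ hm
  · intro h
    exact ⟨⟨n, h⟩, rfl⟩

theorem setCode_injective : Function.Injective setCode.{u} := by
  intro A B h
  ext n
  rw [← natCode_mem_setCode.{u}, h, natCode_mem_setCode]

/-- Mathias conditions `(s, A)` with the infinite set `A` taken from the family `F`:
`s` is finite, `A ∈ F` is infinite, and `max s < min A`. -/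
@[ext]
structure Condition (F : Set (Set ℕ)) where
  stem : Finset ℕ
  side : Set ℕ
  infinite : side.Infinite
  side_mem : side ∈ F
  lt : ∀ m ∈ stem, ∀ n ∈ side, m < n

/-- `(s₁, A₁) ≤ (s₂, A₂)` iff `s₁ ⊇ s₂`, `A₁ ⊆ A₂` and `s₁ \ s₂ ⊆ A₂`. -/
instance conditionPreorder (F : Set (Set ℕ)) : Preorder (Condition F) where
  le p q := q.stem ⊆ p.stem ∧ p.side ⊆ q.side ∧ ∀ n ∈ p.stem, n ∉ q.stem → n ∈ q.side
  le_refl p := ⟨Finset.Subset.refl _, Set.Subset.refl _, fun _ h h' => absurd h h'⟩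
  le_trans p q r hpq hqr := by
    refine ⟨hqr.1.trans hpq.1, hpq.2.1.trans hqr.2.1, fun n hn hn' => ?_⟩
    by_cases h : n ∈ q.stem
    · exact hqr.2.2 n h hn'
    · exact hqr.2.1 (hpq.2.2 n hn h)

/-- The condition `(s, A)` as an ordered pair of sets. -/
def conditionCode {F : Set (Set ℕ)} (p : Condition F) : ZFSet.{u} :=
  ZFSet.pair (setCode (p.stem : Set ℕ)) (setCode p.side)

theorem conditionCode_injective (F : Set (Set ℕ)) :
    Function.Injective (conditionCode.{u} : Condition F → ZFSet.{u}) := by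
  intro p q h
  obtain ⟨h1, h2⟩ := ZFSet.pair_inj.1 h
  exact Condition.ext (Finset.coe_injective (setCode_injective h1)) (setCode_injective h2)

/-- Mathias forcing with side conditions from `F`, as a set of pairs `(s, A)`. -/
def mathias (F : Set (Set ℕ)) : ForcingNotion.{u} :=
  forcingOfPreorder (Condition F) conditionCode (conditionCode_injective F)

/-! ### Submeasures and densities -/

/-- `φ` is a lower semi-continuous submeasure on `ℕ`. -/
structure IsLscSubmeasure (φ : Set ℕ → ℝ≥0∞) : Prop where
  empty : φ ∅ = 0
  mono : ∀ X Y : Set ℕ, X ⊆ Y → φ X ≤ φ Y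
  union_le : ∀ X Y : Set ℕ, φ (X ∪ Y) ≤ φ X + φ Y
  singleton_lt_top : ∀ n : ℕ, φ {n} < ∞
  lsc : ∀ X : Set ℕ, Tendsto (fun n : ℕ => φ (X ∩ Set.Iio n)) atTop (𝓝 (φ X))

/-- `φ⁻(A) = liminf_m φ_m(A)`. -/
def phiMinus (φ : ℕ → Set ℕ → ℝ≥0∞) (A : Set ℕ) : ℝ≥0∞ :=
  liminf (fun m => φ m A) atTop

/-- The lower density `d⁻(A) = liminf_n |A ∩ n| / n`. -/
def lowerDensity (A : Set ℕ) : ℝ :=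
  liminf (fun n : ℕ => ((A ∩ Set.Iio n).ncard : ℝ) / (n : ℝ)) atTop

/-- Mathias forcing with side conditions `A` such that `φ⁻(A) ≥ ε`. -/
def mathiasPhi (φ : ℕ → Set ℕ → ℝ≥0∞) (ε : ℝ) : ForcingNotion.{u} :=
  mathias {A | ENNReal.ofReal ε ≤ phiMinus φ A}

/-- Mathias forcing with side conditions `A` such that `d⁻(A) ≥ ε`. -/
def mathiasLowerDensity (ε : ℝ) : ForcingNotion.{u} :=
  mathias {A | ε ≤ lowerDensity A}

end DensityMathias

end

noncomputable section

namespace DensityMathias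

open FirstOrder Language

/-! ### The structure `H_κ` -/

/-! Properness follows from two features of the family `F` of side sets: closure under removing
finitely many points, and infinite pseudointersections in `F` for decreasing sequences
(`mathias_isProper`). Enumerate the pairs (D, s) with D in M and s a finite stem, and shrink the
side set A of the given condition inside M: if some condition (s, E) with E ⊆ A extends an element
of D, elementarity yields such an E in M below an element of D ∩ M. A pseudointersection B of these
sets gives the generic condition. Any extension of it has side set almost contained in every stage,
so trimming finitely many points brings it below the element of D ∩ M chosen for its stem.

For φ⁻, finite removal is harmless because φ_m tends to 0 on finite sets. Pseudointersections are
glued from finite blocks: by lower semicontinuity an initial piece of A_n already handles the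
finitely many m of stage n (`hasPseudointersections_phiMinus`). Lower density is the case φ_m(A) =
|A ∩ m| / m. -/

theorem mem_H_of_mem {κ : Cardinal.{u}} {x y : ZFSet.{u}} (hx : x ∈ H κ) (hy : y ∈ x) :
    y ∈ H κ := by
  obtain ⟨t, ht, hxt, hc⟩ := hx
  exact ⟨t, ht, ht.subset_of_mem (hxt hy), hc⟩

theorem empty_mem_H {κ : Cardinal.{u}} (hκ : Cardinal.aleph0 ≤ κ) : (∅ : ZFSet.{u}) ∈ H κ :=
  ⟨∅, ZFSet.isTransitive_empty, fun _ h => h, by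
    rw [ZFSet.card_empty]; exact Cardinal.aleph0_pos.trans_le hκ⟩

theorem insert_mem_H {κ : Cardinal.{u}} (hκ : Cardinal.aleph0 ≤ κ) {x y : ZFSet.{u}}
    (hx : x ∈ H κ) (hy : y ∈ H κ) : insert x y ∈ H κ := by
  obtain ⟨s, hs, hxs, hsc⟩ := hx
  obtain ⟨t, ht, hyt, htc⟩ := hy
  refine ⟨insert x (s ∪ t), ?_, ?_, ?_⟩
  · intro z hz w hw
    rw [ZFSet.mem_insert_iff] at hz ⊢
    rcases hz with rfl | hz
    · exact Or.inr (ZFSet.mem_union.2 (Or.inl (hxs hw)))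
    · exact Or.inr ((hs.union ht).subset_of_mem hz hw)
  · intro z hz
    rw [ZFSet.mem_insert_iff] at hz ⊢
    exact hz.imp id fun h => ZFSet.mem_union.2 (Or.inr (hyt h))
  · exact ZFSet.card_insert_le.trans_lt
      (Cardinal.add_lt_of_lt hκ
        (ZFSet.card_union_le.trans_lt (Cardinal.add_lt_of_lt hκ hsc htc))
        (Cardinal.one_lt_aleph0.trans_le hκ))

theorem left_mem_H_of_pair {κ : Cardinal.{u}} {x y : ZFSet.{u}} (h : ZFSet.pair x y ∈ H κ) :
    x ∈ H κ :=
  mem_H_of_mem (mem_H_of_mem h (ZFSet.mem_pair.2 (Or.inl rfl))) (ZFSet.mem_singleton.2 rfl)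

theorem right_mem_H_of_pair {κ : Cardinal.{u}} {x y : ZFSet.{u}} (h : ZFSet.pair x y ∈ H κ) :
    y ∈ H κ :=
  mem_H_of_mem (mem_H_of_mem h (ZFSet.mem_pair.2 (Or.inr rfl))) (ZFSet.mem_pair.2 (Or.inr rfl))

/-- Transitivity of `H κ` makes the quantifier restricted to it lose nothing. -/
theorem H_forall_mem_iff {κ : Cardinal.{u}} (x y : H κ) :
    (∀ z : H κ, (z : ZFSet.{u}) ∈ (x : ZFSet.{u}) → (z : ZFSet.{u}) ∈ (y : ZFSet.{u})) ↔
      (x : ZFSet.{u}) ⊆ y :=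
  ⟨fun h _ hz => h ⟨_, mem_H_of_mem x.2 hz⟩ hz, fun h _ hz => h hz⟩

/-! ### Formulas of set theory -/

/-- `x_i ∈ x_j`. -/
def memF {n : ℕ} (i j : Fin n) : setLang.BoundedFormula Empty n :=
  BoundedFormula.rel (L := setLang) (n := n) (l := 2) SetRel.mem
    ![Term.var (Sum.inr i), Term.var (Sum.inr j)]

/-- `x_i = x_j`. -/
def eqF {n : ℕ} (i j : Fin n) : setLang.BoundedFormula Empty n :=
  BoundedFormula.equal (Term.var (Sum.inr i)) (Term.var (Sum.inr j))

/-- `x_i ⊆ x_j`. -/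
def subF {n : ℕ} (i j : Fin n) : setLang.BoundedFormula Empty n :=
  ((memF (Fin.last n) i.castSucc).imp (memF (Fin.last n) j.castSucc)).all

/-- `x_k = {x_i, x_j}`. -/
def upairF {n : ℕ} (k i j : Fin n) : setLang.BoundedFormula Empty n :=
  ((memF (Fin.last n) k.castSucc).iff
    (eqF (Fin.last n) i.castSucc ⊔ eqF (Fin.last n) j.castSucc)).all

/-- `x_k` is the ordered pair of `x_i` and `x_j`. -/
def pairF {n : ℕ} (k i j : Fin n) : setLang.BoundedFormula Empty n :=
  (upairF (Fin.last n).castSucc i.castSucc.castSucc i.castSucc.castSucc ⊓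
    (upairF (Fin.last (n + 1)) i.castSucc.castSucc j.castSucc.castSucc ⊓
      upairF k.castSucc.castSucc (Fin.last n).castSucc (Fin.last (n + 1)))).ex.ex

/-- The ordered pair of `x_i` and `x_j` belongs to `x_k`. -/
def pairMemF {n : ℕ} (k i j : Fin n) : setLang.BoundedFormula Empty n :=
  (memF (Fin.last n) k.castSucc ⊓ pairF (Fin.last n) i.castSucc j.castSucc).ex

section Realize

variable {κ : Cardinal.{u}} {n : ℕ} (v : Fin n → H κ) (k i j : Fin n)

theorem realize_memF :
    (memF i j).Realize default v ↔ (v i : ZFSet.{u}) ∈ (v j : ZFSet.{u}) :=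
  Iff.rfl

theorem realize_eqF :
    (eqF i j).Realize default v ↔ v i = v j :=
  Iff.rfl

theorem realize_subF :
    (subF i j).Realize default v ↔ (v i : ZFSet.{u}) ⊆ (v j : ZFSet.{u}) := by
  simp only [subF, BoundedFormula.realize_all, BoundedFormula.realize_imp, realize_memF,
    Fin.snoc_castSucc, Fin.snoc_last]
  exact H_forall_mem_iff _ _

theorem realize_upairF :
    (upairF k i j).Realize default v ↔
      (v k : ZFSet.{u}) = {(v i : ZFSet.{u}), (v j : ZFSet.{u})} := by
  simp only [upairF, BoundedFormula.realize_all, BoundedFormula.realize_iff,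
    BoundedFormula.realize_sup, realize_memF, realize_eqF, Fin.snoc_castSucc, Fin.snoc_last]
  constructor
  · intro h
    ext z
    rw [ZFSet.mem_pair]
    constructor
    · intro hz
      exact ((h ⟨z, mem_H_of_mem (v k).2 hz⟩).1 hz).imp
        (fun e => congrArg Subtype.val e) (fun e => congrArg Subtype.val e)
    · rintro (rfl | rfl)
      · exact (h (v i)).2 (Or.inl rfl)
      · exact (h (v j)).2 (Or.inr rfl)
  · intro h z
    rw [h, ZFSet.mem_pair, Subtype.ext_iff, Subtype.ext_iff]

theorem realize_pairF :
    (pairF k i j).Realize default v ↔ (v k : ZFSet.{u}) = ZFSet.pair (v i) (v j) := by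
  simp only [pairF, BoundedFormula.realize_ex, BoundedFormula.realize_inf, realize_upairF,
    Fin.snoc_castSucc, Fin.snoc_last, ZFSet.pair, ZFSet.pair_eq_singleton]
  constructor
  · rintro ⟨a, b, ha, hb, h⟩
    rw [h, ha, hb]
  · intro h
    exact ⟨⟨_, mem_H_of_mem (v k).2 (h ▸ ZFSet.mem_pair.2 (Or.inl rfl))⟩,
      ⟨_, mem_H_of_mem (v k).2 (h ▸ ZFSet.mem_pair.2 (Or.inr rfl))⟩, rfl, rfl, h⟩

theorem realize_pairMemF :
    (pairMemF k i j).Realize default v ↔ ZFSet.pair (v i) (v j) ∈ (v k : ZFSet.{u}) := by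
  simp only [pairMemF, BoundedFormula.realize_ex, BoundedFormula.realize_inf, realize_pairF,
    realize_memF, Fin.snoc_castSucc, Fin.snoc_last]
  constructor
  · rintro ⟨a, ha, h⟩
    rwa [← h]
  · intro h
    exact ⟨⟨_, mem_H_of_mem (v k).2 h⟩, h, rfl⟩

end Realize

/-! ### Closure properties of elementary submodels -/

namespace IsElementarySubmodel

variable {M : Set ZFSet.{u}} {κ : Cardinal.{u}}

theorem mem_H (hM : IsElementarySubmodel M κ) {x : ZFSet.{u}} (hx : x ∈ M) : x ∈ H κ := by
  obtain ⟨S, rfl⟩ := hM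
  obtain ⟨y, -, rfl⟩ := hx
  exact y.2

/-- The Tarski–Vaught property, through which all uses of elementarity pass. -/
theorem exists_mem_of_realize (hM : IsElementarySubmodel M κ) {n : ℕ}
    (θ : setLang.BoundedFormula Empty (n + 1)) (v : Fin n → H κ)
    (hv : ∀ i, (v i : ZFSet.{u}) ∈ M) (a : H κ)
    (h : θ.Realize default (Fin.snoc v a : Fin (n + 1) → H κ)) :
    ∃ b : H κ, (b : ZFSet.{u}) ∈ M ∧ θ.Realize default (Fin.snoc v b : Fin (n + 1) → H κ) := by
  obtain ⟨S, rfl⟩ := hM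
  have hvS : ∀ i, v i ∈ S := fun i => by
    obtain ⟨y, hy, hyv⟩ := hv i
    exact Subtype.ext hyv ▸ hy
  let w : Fin n → S := fun i => ⟨v i, hvS i⟩
  have hw : ∀ d : Empty → S, S.subtype ∘ d = default := fun d => Subsingleton.elim _ _
  have hex : θ.ex.Realize default (S.subtype ∘ w) := BoundedFormula.realize_ex.2 ⟨a, h⟩
  rw [← hw default, S.subtype.map_boundedFormula, BoundedFormula.realize_ex] at hex
  obtain ⟨b, hb⟩ := hex
  rw [← S.subtype.map_boundedFormula, hw, Fin.comp_snoc] at hb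
  exact ⟨b, ⟨b, b.2, rfl⟩, hb⟩

theorem empty_mem (hM : IsElementarySubmodel M κ) (hκ : Cardinal.aleph0 ≤ κ) :
    (∅ : ZFSet.{u}) ∈ M := by
  obtain ⟨b, hb, h⟩ := hM.exists_mem_of_realize (n := 0)
    (memF (Fin.last 1) (Fin.last 0).castSucc).not.all default (fun i => i.elim0)
    ⟨∅, empty_mem_H hκ⟩ (by
      simp only [BoundedFormula.realize_all, BoundedFormula.realize_not, realize_memF,
        Fin.snoc_castSucc, Fin.snoc_last]
      exact fun a => ZFSet.notMem_empty _)
  simp only [BoundedFormula.realize_all, BoundedFormula.realize_not, realize_memF,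
    Fin.snoc_castSucc, Fin.snoc_last] at h
  rwa [(ZFSet.eq_empty _).2 fun z hz => h ⟨z, mem_H_of_mem b.2 hz⟩ hz] at hb

theorem insert_mem (hM : IsElementarySubmodel M κ) (hκ : Cardinal.aleph0 ≤ κ) {x y : ZFSet.{u}}
    (hx : x ∈ M) (hy : y ∈ M) : insert x y ∈ M := by
  have key : ∀ b : H κ, ((memF (3 : Fin 4) 2).iff (eqF 3 0 ⊔ memF 3 1)).all.Realize default
      (Fin.snoc ![⟨x, hM.mem_H hx⟩, ⟨y, hM.mem_H hy⟩] b : Fin 3 → H κ) ↔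
        ∀ z : H κ, (z : ZFSet.{u}) ∈ (b : ZFSet.{u}) ↔ (z : ZFSet.{u}) ∈ insert x y := by
    intro b
    simp only [BoundedFormula.realize_all, BoundedFormula.realize_iff,
      BoundedFormula.realize_sup, realize_memF, realize_eqF, ZFSet.mem_insert_iff]
    refine forall_congr' fun z => iff_congr Iff.rfl (or_congr ?_ Iff.rfl)
    exact Subtype.ext_iff
  obtain ⟨b, hb, h⟩ := hM.exists_mem_of_realize _ _
    (by intro i; fin_cases i; exacts [hx, hy])
    ⟨_, insert_mem_H hκ (hM.mem_H hx) (hM.mem_H hy)⟩ ((key _).2 fun _ => Iff.rfl)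
  have hb' : (b : ZFSet.{u}) = insert x y := by
    ext z
    constructor
    · exact fun hz => ((key b).1 h ⟨z, mem_H_of_mem b.2 hz⟩).1 hz
    · exact fun hz => ((key b).1 h ⟨z, mem_H_of_mem
        (insert_mem_H hκ (hM.mem_H hx) (hM.mem_H hy)) hz⟩).2 hz
  rwa [hb'] at hb

theorem right_mem_of_pair_mem (hM : IsElementarySubmodel M κ) {x y : ZFSet.{u}}
    (h : ZFSet.pair x y ∈ M) : y ∈ M := by
  have key : ∀ b : H κ, (pairF (0 : Fin 3) 2 1).ex.Realize default
      (Fin.snoc ![⟨_, hM.mem_H h⟩] b : Fin 2 → H κ) ↔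
        ∃ a : H κ, ZFSet.pair x y = ZFSet.pair a b := by
    intro b
    simp only [BoundedFormula.realize_ex, realize_pairF]
    rfl
  obtain ⟨b, hb, hb'⟩ := hM.exists_mem_of_realize _ _
    (by intro i; fin_cases i; exact h) ⟨y, right_mem_H_of_pair (hM.mem_H h)⟩
    ((key _).2 ⟨⟨x, left_mem_H_of_pair (hM.mem_H h)⟩, rfl⟩)
  obtain ⟨a, ha⟩ := (key b).1 hb'
  rwa [(ZFSet.pair_inj.1 ha).2]

theorem natCode_mem (hM : IsElementarySubmodel M κ) (hκ : Cardinal.aleph0 ≤ κ) (n : ℕ) :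
    natCode n ∈ M := by
  induction n with
  | zero => exact hM.empty_mem hκ
  | succ n ih => exact hM.insert_mem hκ ih ih

theorem setCode_mem_of_finset (hM : IsElementarySubmodel M κ) (hκ : Cardinal.aleph0 ≤ κ)
    (s : Finset ℕ) : setCode (s : Set ℕ) ∈ M := by
  induction s using Finset.induction_on with
  | empty =>
    convert hM.empty_mem hκ
    refine (ZFSet.eq_empty _).2 fun z hz => ?_
    obtain ⟨⟨n, hn⟩, -⟩ := ZFSet.mem_range.1 hz
    simp at hn
  | insert n s _ ih =>
    convert hM.insert_mem hκ (hM.natCode_mem hκ n) ih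
    ext z
    simp only [setCode, ZFSet.mem_insert_iff, ZFSet.mem_range, Subtype.exists, Finset.mem_coe,
      Finset.mem_insert, exists_prop]
    constructor
    · rintro ⟨m, rfl | hm, rfl⟩
      · exact Or.inl rfl
      · exact Or.inr ⟨m, hm, rfl⟩
    · rintro (rfl | ⟨m, hm, rfl⟩)
      · exact ⟨n, Or.inl rfl, rfl⟩
      · exact ⟨m, Or.inr hm, rfl⟩

/-- If some `E ⊆ a` is such that the pair `(s, E)` is below an element of `D` in the relation
`r`, then an elementary submodel containing the parameters has such an `E` and a witness in `D`. -/
theorem exists_pair_below (hM : IsElementarySubmodel M κ) {D r s a : ZFSet.{u}}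
    (hD : D ∈ M) (hr : r ∈ M) (hs : s ∈ M) (ha : a ∈ M)
    (h : ∃ E ⊆ a, ∃ d ∈ D, ZFSet.pair (ZFSet.pair s E) d ∈ r) :
    ∃ E ⊆ a, E ∈ M ∧ ∃ d ∈ D, d ∈ M ∧ ZFSet.pair (ZFSet.pair s E) d ∈ r := by
  obtain ⟨E, hE, d, hd, hEd⟩ := h
  have hpair : ZFSet.pair s E ∈ H κ :=
    left_mem_H_of_pair (mem_H_of_mem (hM.mem_H hr) hEd)
  let v : Fin 4 → H κ :=
    ![⟨D, hM.mem_H hD⟩, ⟨r, hM.mem_H hr⟩, ⟨s, hM.mem_H hs⟩, ⟨a, hM.mem_H ha⟩]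
  have hv : ∀ i, (v i : ZFSet.{u}) ∈ M := by
    intro i; fin_cases i; exacts [hD, hr, hs, ha]
  let θ : setLang.BoundedFormula Empty 6 :=
    subF 5 3 ⊓ (memF 4 0 ⊓ (pairF 6 2 5 ⊓ pairMemF 1 6 4 : setLang.BoundedFormula Empty 7).ex)
  have key : ∀ d E : H κ, θ.Realize default
      (Fin.snoc (Fin.snoc v d : Fin 5 → H κ) E : Fin 6 → H κ) ↔
        (E : ZFSet.{u}) ⊆ a ∧ (d : ZFSet.{u}) ∈ D ∧
          ∃ x : H κ, (x : ZFSet.{u}) = ZFSet.pair s E ∧ ZFSet.pair x d ∈ r := by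
    intro d E
    simp only [θ, BoundedFormula.realize_ex, BoundedFormula.realize_inf, realize_pairF,
      realize_subF, realize_memF, realize_pairMemF]
    rfl
  -- Witnesses are pulled into `M` one at a time: first `d'`, then `E'` with `d'` as an additional
  -- parameter.
  obtain ⟨d', hd', h'⟩ := hM.exists_mem_of_realize θ.ex v hv ⟨d, mem_H_of_mem (hM.mem_H hD) hd⟩
    (BoundedFormula.realize_ex.2 ⟨⟨E, right_mem_H_of_pair hpair⟩,
      (key _ _).2 ⟨hE, hd, ⟨_, hpair⟩, rfl, hEd⟩⟩)
  obtain ⟨E₁, h₁⟩ := BoundedFormula.realize_ex.1 h'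
  obtain ⟨E', hE', h₂⟩ := hM.exists_mem_of_realize θ (Fin.snoc v d' : Fin 5 → H κ)
    (by intro i; fin_cases i; exacts [hD, hr, hs, ha, hd']) E₁ h₁
  obtain ⟨hsub, hdD, x, hx, hxd⟩ := (key _ _).1 h₂
  exact ⟨E', hsub, hE', d', hdD, hd', hx ▸ hxd⟩

end IsElementarySubmodel

/-! ### Mathias forcing as a set -/

theorem setCode_subset_setCode {A B : Set ℕ} : setCode.{u} A ⊆ setCode.{u} B ↔ A ⊆ B := by
  constructor
  · exact fun h n hn => natCode_mem_setCode.{u}.1 (h (natCode_mem_setCode.2 hn))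
  · intro h z hz
    obtain ⟨⟨n, hn⟩, rfl⟩ := ZFSet.mem_range.1 hz
    exact natCode_mem_setCode.2 (h hn)

section Mathias

variable {F : Set (Set ℕ)}

theorem mem_mathias_carrier {x : ZFSet.{u}} :
    x ∈ (mathias F).carrier ↔ ∃ p : Condition F, conditionCode p = x :=
  ZFSet.mem_range

theorem pair_mem_mathias_rel {x y : ZFSet.{u}} :
    ZFSet.pair x y ∈ (mathias F).rel ↔
      ∃ p q : Condition F, conditionCode p = x ∧ conditionCode q = y ∧ p ≤ q := by
  refine ZFSet.mem_range.trans ⟨?_, ?_⟩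
  · rintro ⟨⟨⟨p, q⟩, hpq⟩, h⟩
    exact ⟨p, q, (ZFSet.pair_inj.1 h).1, (ZFSet.pair_inj.1 h).2, hpq⟩
  · rintro ⟨p, q, rfl, rfl, hpq⟩
    exact ⟨⟨(p, q), hpq⟩, rfl⟩

theorem mathias_LE_conditionCode {p q : Condition F} :
    (mathias.{u} F).LE (conditionCode p) (conditionCode q) ↔ p ≤ q := by
  refine pair_mem_mathias_rel.trans ⟨?_, fun h => ⟨p, q, rfl, rfl, h⟩⟩
  rintro ⟨p', q', hp, hq, h⟩
  rwa [conditionCode_injective F hp, conditionCode_injective F hq] at h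

/-- The condition obtained by shrinking the side set. -/
def Condition.shrink (p : Condition F) (B : Set ℕ) (hB : B.Infinite) (hBF : B ∈ F)
    (h : B ⊆ p.side) : Condition F :=
  ⟨p.stem, B, hB, hBF, fun m hm n hn => p.lt m hm n (h hn)⟩

theorem Condition.shrink_le (p : Condition F) {B : Set ℕ} (hB : B.Infinite) (hBF : B ∈ F)
    (h : B ⊆ p.side) : p.shrink B hB hBF h ≤ p :=
  ⟨Finset.Subset.refl _, h, fun _ hn hn' => absurd hn hn'⟩

end Mathias

/-! ### A criterion for properness -/

/-- The family `F` is closed under the removal of finitely many points. -/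
def FiniteRemovalClosed (F : Set (Set ℕ)) : Prop :=
  ∀ A ∈ F, ∀ B ⊆ A, (A \ B).Finite → B ∈ F

/-- Every decreasing sequence of infinite members of `F` has an infinite pseudointersection in `F`
that is contained in the first member. -/
def HasPseudointersections (F : Set (Set ℕ)) : Prop :=
  ∀ A : ℕ → Set ℕ, Antitone A → (∀ n, (A n).Infinite) → (∀ n, A n ∈ F) →
    ∃ B ∈ F, B.Infinite ∧ B ⊆ A 0 ∧ ∀ n, (B \ A n).Finite

/-- The condition with stem `s` and side set `A` extends an element of `D` that lies in `M`. -/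
def Reduces (F : Set (Set ℕ)) (M : Set ZFSet.{u}) (D : ZFSet.{u}) (s : Finset ℕ)
    (A : Set ℕ) : Prop :=
  ∃ d ∈ D, d ∈ M ∧ ∃ c : Condition F, c.stem = s ∧ c.side = A ∧
    (mathias F).LE (conditionCode c) d

/-- The side set of `c` need not lie in `M`; its existence suffices, since the finite stem, `A`, `D`
and the order are parameters in `M`. -/
theorem exists_subset_reduces {F : Set (Set ℕ)} {M : Set ZFSet.{u}} {κ : Cardinal.{u}}
    (hM : IsElementarySubmodel M κ) (hκ : Cardinal.aleph0 ≤ κ) (hr : (mathias.{u} F).rel ∈ M)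
    {D : ZFSet.{u}} (hD : D ∈ M) (s : Finset ℕ) {A : Set ℕ} (hA : setCode A ∈ M)
    {c : Condition F} (hcs : c.stem = s) (hcA : c.side ⊆ A) {d : ZFSet.{u}} (hd : d ∈ D)
    (hcd : (mathias F).LE (conditionCode c) d) :
    ∃ A' ⊆ A, A'.Infinite ∧ A' ∈ F ∧ setCode.{u} A' ∈ M ∧ Reduces F M D s A' := by
  obtain ⟨E, hEA, hEM, d', hd', hdM, hle⟩ :=
    hM.exists_pair_below hD hr (hM.setCode_mem_of_finset hκ s) hA
      ⟨setCode c.side, setCode_subset_setCode.2 hcA, d, hd, hcs ▸ hcd⟩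
  obtain ⟨c', q, hc', rfl, -⟩ := pair_mem_mathias_rel.1 hle
  obtain ⟨hs, rfl⟩ := ZFSet.pair_inj.1 hc'
  refine ⟨c'.side, setCode_subset_setCode.1 hEA, c'.infinite, c'.side_mem, hEM, _, hd', hdM, c',
    Finset.coe_injective (setCode_injective hs), rfl, ?_⟩
  rwa [← hc'] at hle

theorem mathias_isProper {F : Set (Set ℕ)} (hfin : FiniteRemovalClosed F)
    (hps : HasPseudointersections F) : (mathias.{u} F).IsProper := by
  intro κ hκ _ M hMc hM _ hr p hp hpM
  obtain ⟨p, rfl⟩ := mem_mathias_carrier.1 hp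
  have hκ' := hκ.aleph0_le
  have hsideM : setCode p.side ∈ M := hM.right_mem_of_pair_mem hpM
  have : Countable M := hMc
  have : Nonempty M := ⟨⟨_, hpM⟩⟩
  obtain ⟨e, he⟩ := exists_surjective_nat (M × Finset ℕ)
  have step : ∀ (n : ℕ) (A : {A : Set ℕ // A.Infinite ∧ A ∈ F ∧ setCode A ∈ M}),
      ∃ A' : {A : Set ℕ // A.Infinite ∧ A ∈ F ∧ setCode A ∈ M}, A'.1 ⊆ A.1 ∧
        ((∃ c : Condition F, c.stem = (e n).2 ∧ c.side ⊆ A.1 ∧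
            ∃ d ∈ (e n).1.1, (mathias F).LE (conditionCode c) d) →
          Reduces F M (e n).1 (e n).2 A'.1) := by
    intro n A
    by_cases h : ∃ c : Condition F, c.stem = (e n).2 ∧ c.side ⊆ A.1 ∧
        ∃ d ∈ (e n).1.1, (mathias F).LE (conditionCode c) d
    · obtain ⟨c, hcs, hcA, d, hd, hcd⟩ := h
      obtain ⟨A', hA', hinf, hF, hA'M, hred⟩ :=
        exists_subset_reduces hM hκ' hr (e n).1.2 (e n).2 A.2.2.2 hcs hcA hd hcd
      exact ⟨⟨A', hinf, hF, hA'M⟩, hA', fun _ => hred⟩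
    · exact ⟨A, subset_rfl, fun h' => absurd h' h⟩
  choose next hnext hred using step
  let A : ℕ → {A : Set ℕ // A.Infinite ∧ A ∈ F ∧ setCode A ∈ M} :=
    fun n => Nat.rec ⟨p.side, p.infinite, p.side_mem, hsideM⟩ next n
  obtain ⟨B, hBF, hBinf, hB0, hBA⟩ := hps (fun n => (A n).1)
    (antitone_nat_of_succ_le fun n => hnext n (A n)) (fun n => (A n).2.1) (fun n => (A n).2.2.1)
  refine ⟨conditionCode (p.shrink B hBinf hBF hB0),
    mathias_LE_conditionCode.2 (p.shrink_le hBinf hBF hB0),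
    mem_mathias_carrier.2 ⟨_, rfl⟩, ?_⟩
  rintro D hDM ⟨-, hDdense⟩ r hrq
  obtain ⟨r, q, rfl, hq, hrq⟩ := pair_mem_mathias_rel.1 hrq
  obtain rfl := conditionCode_injective F hq
  obtain ⟨d, hd, hdr⟩ := hDdense (conditionCode r) (mem_mathias_carrier.2 ⟨r, rfl⟩)
  obtain ⟨x, _, rfl, hx, hxr⟩ := pair_mem_mathias_rel.1 hdr
  obtain rfl := conditionCode_injective F hx
  obtain ⟨n, hn⟩ := he (⟨D, hDM⟩, x.stem)
  have hxB : x.side ⊆ B := hxr.2.1.trans hrq.2.1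
  have hdiff : ∀ k, (x.side \ (x.side ∩ (A k).1)).Finite := fun k =>
    (hBA k).subset fun m hm => ⟨hxB hm.1, fun h => hm.2 ⟨hm.1, h⟩⟩
  have hinter : ∀ k, (x.side ∩ (A k).1) ∈ F ∧ (x.side ∩ (A k).1).Infinite := fun k => by
    refine ⟨hfin _ x.side_mem _ Set.inter_subset_left (hdiff k), fun h => x.infinite ?_⟩
    exact (h.union (hdiff k)).subset fun m hm => by
      by_cases hmA : m ∈ (A k).1
      exacts [Or.inl ⟨hm, hmA⟩, Or.inr ⟨hm, fun h => hmA h.2⟩]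
  have hshrink : ∀ k, x.shrink _ (hinter k).2 (hinter k).1 Set.inter_subset_left ≤ x :=
    fun k => x.shrink_le _ _ _
  -- Trimming `x` into `A n` triggers the positive alternative at stage `n`, so `A (n + 1)` with the
  -- same stem lies below an element of `D` in `M`.
  obtain ⟨d, hdD, hdM, c, hcs, hcA, hcd⟩ := hred n (A n)
    ⟨x.shrink _ (hinter n).2 (hinter n).1 Set.inter_subset_left, by rw [hn]; rfl,
      Set.inter_subset_right, conditionCode x, by rw [hn]; exact hd,
      mathias_LE_conditionCode.2 (hshrink n)⟩
  rw [hn] at hdD hcs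
  let y := x.shrink _ (hinter (n + 1)).2 (hinter (n + 1)).1 Set.inter_subset_left
  have hyc : y ≤ c := by
    refine ⟨hcs.subset, ?_, fun m hm hm' => absurd (hcs ▸ hm) hm'⟩
    rw [hcA]
    exact Set.inter_subset_right
  exact ⟨d, hdD, hdM, conditionCode y, mem_mathias_carrier.2 ⟨y, rfl⟩,
    (mathias F).trans _ _ _ (mathias_LE_conditionCode.2 hyc) hcd,
    mathias_LE_conditionCode.2 ((hshrink (n + 1)).trans hxr)⟩

/-! ### Side conditions with large lower submeasure -/

section PhiMinus

variable {φ : ℕ → Set ℕ → ℝ≥0∞}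

/-- Placing the slack δ on the right avoids truncated subtraction and treats `e = 0` uniformly. -/
theorem le_phiMinus_iff {e : ℝ≥0∞} (he : e ≠ ∞) {A : Set ℕ} :
    e ≤ phiMinus φ A ↔ ∀ δ : ℝ≥0∞, δ ≠ 0 → ∀ᶠ m in atTop, e < φ m A + δ := by
  rw [phiMinus, le_liminf_iff]
  constructor
  · intro h δ hδ
    rcases eq_or_ne e 0 with rfl | he0
    · exact Eventually.of_forall fun m => (pos_iff_ne_zero.2 hδ).trans_le le_add_self
    · rcases eq_or_ne δ ∞ with rfl | hδ'
      · exact Eventually.of_forall fun m => by simpa using he.lt_top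
      · filter_upwards [h _ (ENNReal.sub_lt_self he he0 hδ)] with m hm
        exact (le_tsub_add (a := δ) (b := e)).trans_lt ((ENNReal.add_lt_add_iff_right hδ').2 hm)
  · intro h b hb
    filter_upwards [h (e - b) (tsub_pos_of_lt hb).ne'] with m hm
    rw [← add_tsub_cancel_of_le hb.le] at hm
    rw [add_tsub_cancel_of_le hb.le] at hm
    refine lt_of_add_lt_add_right (a := e - b) ?_
    rwa [add_tsub_cancel_of_le hb.le]

theorem IsLscSubmeasure.tendsto_finite (hφ : ∀ m, IsLscSubmeasure (φ m))
    (h0 : ∀ n : ℕ, Tendsto (fun m => φ m {n}) atTop (𝓝 0)) {s : Set ℕ} (hs : s.Finite) :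
    Tendsto (fun m => φ m s) atTop (𝓝 0) := by
  induction s, hs using Set.Finite.induction_on with
  | empty => simp [(hφ _).empty]
  | @insert n s _ _ ih =>
    refine tendsto_of_tendsto_of_tendsto_of_le_of_le tendsto_const_nhds
      (by simpa using (h0 n).add ih) (fun _ => zero_le) fun m => ?_
    exact (hφ m).union_le {n} s

theorem finiteRemovalClosed_phiMinus (hφ : ∀ m, IsLscSubmeasure (φ m))
    (h0 : ∀ n : ℕ, Tendsto (fun m => φ m {n}) atTop (𝓝 0)) {e : ℝ≥0∞} (he : e ≠ ∞) :
    FiniteRemovalClosed {A | e ≤ phiMinus φ A} := by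
  intro A hA B hBA hfin
  refine (le_phiMinus_iff he).2 fun δ hδ => ?_
  have hδ2 : δ / 2 ≠ 0 := (ENNReal.half_pos hδ).ne'
  filter_upwards [(le_phiMinus_iff he).1 hA _ hδ2,
    (IsLscSubmeasure.tendsto_finite hφ h0 hfin).eventually_lt_const (pos_iff_ne_zero.2 hδ2)]
    with m h1 h2
  calc e < φ m A + δ / 2 := h1
    _ = φ m (B ∪ A \ B) + δ / 2 := by rw [Set.union_sdiff_cancel hBA]
    _ ≤ φ m B + δ / 2 + δ / 2 := by gcongr; exact ((hφ m).union_le _ _).trans (by gcongr)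
    _ = φ m B + δ := by rw [add_assoc, ENNReal.add_halves]

theorem hasPseudointersections_phiMinus (hφ : ∀ m, IsLscSubmeasure (φ m)) {e : ℝ≥0∞}
    (he : e ≠ ∞) : HasPseudointersections {A | e ≤ phiMinus φ A} := by
  intro A hA hinf hAe
  let δ : ℕ → ℝ≥0∞ := fun n => ((n : ℝ≥0∞) + 1)⁻¹
  have hδ : ∀ n, δ n ≠ 0 := fun n => ENNReal.inv_ne_zero.2 (by finiteness)
  -- The bound `n ≤ N` makes the thresholds unbounded, so every large `m` falls into some stage;
  -- monotonicity of `N` is not needed.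
  have hlarge : ∀ n, ∃ N, n ≤ N ∧ ∀ m ≥ N, e < φ m (A n) + δ n := fun n => by
    obtain ⟨N, hN⟩ := eventually_atTop.1 ((le_phiMinus_iff he).1 (hAe n) (δ n) (hδ n))
    exact ⟨max n N, le_max_left _ _, fun m hm => hN m ((le_max_right _ _).trans hm)⟩
  choose N hnN hN using hlarge
  -- Lower semicontinuity supplies one cutoff for finitely many `m`; the point `x` in the block will
  -- make `B` infinite.
  have hstep : ∀ n k, ∃ k', k < k' ∧ (∃ x ∈ A n, k ≤ x ∧ x < k') ∧
      ∀ m < N (n + 1), N n ≤ m → e < φ m (A n ∩ Set.Iio k') + δ n := by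
    intro n k
    obtain ⟨x, hx, hkx⟩ := (hinf n).exists_gt k
    have hev : ∀ᶠ k' in atTop, ∀ m ∈ Set.Iio (N (n + 1)), N n ≤ m →
        e < φ m (A n ∩ Set.Iio k') + δ n := by
      refine (eventually_all_finite (Set.finite_Iio _)).2 fun m _ => ?_
      by_cases hm : N n ≤ m
      · filter_upwards [(((hφ m).lsc (A n)).add_const (δ n)).eventually_const_lt (hN n m hm)]
          with k' hk' _ using hk'
      · exact Eventually.of_forall fun _ h => absurd h hm
    obtain ⟨k', hk', hxk'⟩ := (hev.and (eventually_gt_atTop x)).exists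
    exact ⟨k', hkx.trans hxk', ⟨x, hx, hkx.le, hxk'⟩, hk'⟩
  choose next hlt hne hbig using hstep
  let k : ℕ → ℕ := fun n => Nat.rec 0 next n
  have hk : StrictMono k := strictMono_nat_of_lt_succ fun n => hlt n (k n)
  -- As `A` decreases and `k 0 = 0`, this is the union of the blocks `A n ∩ [k n, k (n + 1))`.
  let B : Set ℕ := {x | ∀ n, k n ≤ x → x ∈ A n}
  have hsub : ∀ n, A n ∩ Set.Iio (k (n + 1)) ⊆ B := fun n x hx j hj =>
    hA (Nat.lt_succ_iff.1 (hk.lt_iff_lt.1 (hj.trans_lt hx.2))) hx.1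
  refine ⟨B, (le_phiMinus_iff he).2 fun ε hε => ?_, ?_, fun x hx => hx 0 (Nat.zero_le x),
    fun n => (Set.finite_Iio (k n)).subset fun x hx => ?_⟩
  · obtain ⟨n₀, hn₀⟩ := ENNReal.exists_inv_nat_lt hε
    filter_upwards [eventually_ge_atTop (N n₀)] with m hm
    have hex : ∃ j, m < N (n₀ + j + 1) := ⟨m, lt_of_lt_of_le (by omega) (hnN _)⟩
    classical
    -- Minimality of the index places `m` in the interval from `N` at that index up to its next
    -- value.
    have hlow : N (n₀ + Nat.find hex) ≤ m := by
      rcases h : Nat.find hex with _ | j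
      · exact hm
      · exact not_lt.1 (Nat.find_min hex (m := j) (by omega))
    calc e < φ m (A _ ∩ Set.Iio (k (_ + 1))) + δ (n₀ + Nat.find hex) :=
          hbig _ (k _) m (Nat.find_spec hex) hlow
      _ ≤ φ m B + ε := by
          gcongr
          · exact (hφ m).mono _ _ (hsub _)
          · refine le_trans (ENNReal.inv_le_inv.2 ?_) hn₀.le
            exact_mod_cast (by omega : n₀ ≤ n₀ + Nat.find hex + 1)
  · refine Set.infinite_of_forall_exists_gt fun a => ?_
    obtain ⟨x, hx, hkx, hxk⟩ := hne (a + 1) (k (a + 1))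
    exact ⟨x, hsub (a + 1) ⟨hx, hxk⟩, lt_of_lt_of_le (hk.le_apply (x := a + 1)) hkx⟩
  · exact not_le.1 fun h => hx.2 (hx.1 n h)

theorem mathiasPhi_isProper (hφ : ∀ m, IsLscSubmeasure (φ m))
    (h0 : ∀ n : ℕ, Tendsto (fun m => φ m {n}) atTop (𝓝 0)) (ε : ℝ) :
    (mathiasPhi.{u} φ ε).IsProper :=
  mathias_isProper (finiteRemovalClosed_phiMinus hφ h0 ENNReal.ofReal_ne_top)
    (hasPseudointersections_phiMinus hφ ENNReal.ofReal_ne_top)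

end PhiMinus

/-! ### Lower density -/

/-- The submeasures `A ↦ |A ∩ m| / m`. -/
def initialDensity (m : ℕ) (A : Set ℕ) : ℝ≥0∞ :=
  ENNReal.ofReal (((A ∩ Set.Iio m).ncard : ℝ) / (m : ℝ))

theorem initialDensity_isLscSubmeasure (m : ℕ) : IsLscSubmeasure (initialDensity m) where
  empty := by simp [initialDensity]
  mono X Y h := by
    unfold initialDensity
    gcongr
    exact (Set.finite_Iio m).inter_of_right Y
  union_le X Y := by
    unfold initialDensity
    rw [← ENNReal.ofReal_add (by positivity) (by positivity), ← add_div,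
      Set.union_inter_distrib_right]
    gcongr
    exact_mod_cast Set.ncard_union_le _ _
  singleton_lt_top n := ENNReal.ofReal_lt_top
  lsc X := by
    -- Only `X ∩ m` matters, so the sequence is constant from `n = m` on.
    refine tendsto_const_nhds.congr' ?_
    filter_upwards [eventually_ge_atTop m] with n hn
    rw [initialDensity, initialDensity, Set.inter_assoc,
      Set.inter_eq_right.2 (Set.Iio_subset_Iio hn)]

theorem tendsto_initialDensity_singleton (n : ℕ) :
    Tendsto (fun m => initialDensity m {n}) atTop (𝓝 0) := by
  rw [← ENNReal.ofReal_zero]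
  refine ENNReal.tendsto_ofReal ?_
  refine squeeze_zero (fun m => by positivity) (fun m => ?_)
    (tendsto_const_div_atTop_nhds_zero_nat 1)
  gcongr
  exact_mod_cast (Set.ncard_le_ncard Set.inter_subset_left).trans (Set.ncard_singleton n).le

theorem relativeCount_mem_Icc (A : Set ℕ) (n : ℕ) :
    ((A ∩ Set.Iio n).ncard : ℝ) / (n : ℝ) ∈ Set.Icc (0 : ℝ) 1 := by
  refine ⟨by positivity, div_le_one_of_le₀ ?_ (Nat.cast_nonneg n)⟩
  exact_mod_cast (Set.ncard_le_ncard Set.inter_subset_right (Set.finite_Iio n)).trans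
    (by simp [Set.ncard_eq_toFinset_card'])

theorem lowerDensity_nonneg (A : Set ℕ) : 0 ≤ lowerDensity A :=
  le_liminf_of_le
    (isBoundedUnder_of ⟨1, fun n => (relativeCount_mem_Icc A n).2⟩).isCoboundedUnder_ge
    (Eventually.of_forall fun n => (relativeCount_mem_Icc A n).1)

/-- A continuous monotone map commutes with liminf; the bounds 0 and 1 keep the real liminf
meaningful. -/
theorem ofReal_lowerDensity (A : Set ℕ) :
    ENNReal.ofReal (lowerDensity A) = phiMinus initialDensity A :=
  ENNReal.ofReal_mono.map_liminf_of_continuousAt _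
    ENNReal.continuous_ofReal.continuousAt
    (isBoundedUnder_of ⟨1, fun n => (relativeCount_mem_Icc A n).2⟩).isCoboundedUnder_ge
    (isBoundedUnder_of ⟨0, fun n => (relativeCount_mem_Icc A n).1⟩)

theorem mathiasLowerDensity_eq_mathiasPhi (ε : ℝ) :
    mathiasLowerDensity.{u} ε = mathiasPhi initialDensity ε := by
  unfold mathiasLowerDensity mathiasPhi
  congr 1
  ext A
  rw [Set.mem_ofPred_eq, Set.mem_ofPred_eq, ← ofReal_lowerDensity,
    ENNReal.ofReal_le_ofReal_iff (lowerDensity_nonneg A)]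

end DensityMathias

end

theorem mainTheorem1 :
    (∀ φ : ℕ → Set ℕ → ℝ≥0∞,
      (∀ m, DensityMathias.IsLscSubmeasure (φ m)) →
      (∀ n : ℕ, Tendsto (fun m => φ m {n}) atTop (𝓝 0)) →
      ∀ ε : ℝ, 0 ≤ ε → (DensityMathias.mathiasPhi.{u} φ ε).IsProper) ∧
    (∀ ε : ℝ, 0 ≤ ε → ε ≤ 1 → (DensityMathias.mathiasLowerDensity.{u} ε).IsProper) := by
  refine ⟨fun φ hφ h0 ε _ => DensityMathias.mathiasPhi_isProper hφ h0 ε, fun ε _ _ => ?_⟩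
  rw [DensityMathias.mathiasLowerDensity_eq_mathiasPhi]
  exact DensityMathias.mathiasPhi_isProper DensityMathias.initialDensity_isLscSubmeasure
    DensityMathias.tendsto_initialDensity_singleton ε
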